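/- Let $K\subset S^3$ be a (tame) knot with open tubular neighbourhood $V(K)$, let $X=S^3\setminus V(K)$, let $\pi=\pi_1(X)$ be the knot group and $\mu\in\pi$ a meridian. Write $\pi'=[\pi,\pi]$, $\pi''=[\pi',\pi']$, and let $\gamma\mapsto|\gamma|$ be the canonical projection $\pi\to\pi/\pi'\cong\mathbb Z$, where the isomorphism is normalised by $|\mu|=1$. Let $\Lambda=\mathbb C[t,t^{-1}]$. The complex Alexander module is $H=\pi'/\pi''\otimes_{\mathbb Z}\mathbb C$ with $t\cdot(y\otimes z)=(\mu y\mu^{-1})\otimes z$; the Alexander polynomial $\Delta_K$ is a generator of its order ideal (the zeroth Fitting ideal). Let $$H\cong\bigoplus_{\Delta_K(\beta)=0}\ \bigoplus_{i=1}^{k_\beta}\Lambda/(t-\beta)^{q_{\beta,i}},\qquad 1\le q_{\beta,1}\le\dots\le q_{\beta,k_\beta},$$ be a decomposition of $H$ as a finite direct sum. For $\alpha\in\mathbb C^*$ let $\mathbb C_\alpha$ be the $\pi$-module $\mathbb C$ with $\gamma\cdot z=\alpha^{|\gamma|}z$, and let $B^1(\pi,\mathbb C_\alpha)\subseteq Z^1(\pi,\mathbb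 C_\alpha)$ be the spaces of 1-coboundaries and 1-cocycles. Let $J_m$ be the $m\times m$ matrix with $1$ on the diagonal and on the first superdiagonal and $0$ elsewhere, and $\phi_m(\gamma)=J_m^{|\gamma|}$. For $n\ge2$ let $G_n$ be the group of invertible upper triangular complex $n\times n$ matrices, and let $C_n=C_n(\alpha)$ be the linear subspace of those $U\in Z^1(\pi,\mathbb C_\alpha)$ for which there are functions $v_2,\dots,v_{n-1}:\pi\to\mathbb C$ such that $$\gamma\longmapsto\begin{pmatrix}\alpha^{|\gamma|}&(U(\gamma),v_2(\gamma),\dots,v_{n-1}(\gamma))\\0&\phi_{n-1}(\gamma)\end{pmatrix}$$ is a group homomorphism $\pi\to G_n$. Let $\alpha$ be a root of $\Delta_K$ and write $k_\alpha$ and $q_i=q_{\alpha,i}$. Then $Z^1(\pi,\mathbb C_\alpha)$ is finite-dimensional, $k_\alpha\ge1$, and: 1. $C_{n+1}\subseteq C_n$ for all $n\ge2$, and $$B^1(\pi,\mathbb C_\alpha)=C_{q_{k_\alpha}+2}\subsetneq C_{q_{k_\alpha}+1}\subseteq C_{q_{k_\alpha}}\subseteq\dots\subseteq C_2=Z^1(\pi,\mathbb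 C_\alpha).$$ 2. For every $p\ge3$, $\dim C_{p-1}-\dim C_p=\operatorname{card}\{1\le i\le k_\alpha\mid q_i=p-2\}$. Consequently the filtrations $(C_p(\beta))_{p\ge2}$ recover the decomposition of the complex Alexander module: as $\Lambda$-modules, $$H\cong\bigoplus_{\Delta_K(\beta)=0}\ \bigoplus_{m\ge1}\bigl(\Lambda/(t-\beta)^m\bigr)^{\dim C_{m+1}(\beta)-\dim C_{m+2}(\beta)}.$$ -/

import Mathlib

open scoped TensorProduct DirectSum LaurentPolynomial unitInterval

noncomputable section

namespace KnotModule

/-! ### Knots, exteriors and meridians -/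

/-- The three-dimensional sphere. -/
abbrev S3 : Type := Metric.sphere (0 : EuclideanSpace ℝ (Fin 4)) 1

/-- A (tame) knot in the three-sphere, together with a tubular neighbourhood, that is an open
embedding of `S¹ × ℂ`.  The knot itself is the image of `S¹ × {0}`. -/
structure Knot where
  tube : Circle × ℂ → S3
  isOpenEmbedding : Topology.IsOpenEmbedding tube

namespace Knot

variable (K : Knot)

/-- The underlying simple closed curve in the sphere. -/
def carrier : Set S3 := Set.range fun z : Circle => K.tube (z, 0)

/-- The open tubular neighbourhood of radius one around the knot. -/
def nbhd : Set S3 := K.tube '' (Set.univ ×ˢ Metric.ball 0 1)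

/-- The exterior of the knot: the complement of the open tubular neighbourhood. -/
abbrev Exterior : Type := {x : S3 // x ∉ K.nbhd}

theorem tube_circle_notMem (w : Circle) : K.tube (1, (w : ℂ)) ∉ K.nbhd := by
  rintro ⟨⟨a, b⟩, ⟨-, hb⟩, hab⟩
  have h := K.isOpenEmbedding.injective hab
  obtain ⟨-, rfl⟩ := Prod.mk.inj h
  simp [Circle.norm_coe] at hb

/-- The boundary circle of the fibre of the tubular neighbourhood over `1`, as a loop in the
exterior. -/
def meridianLoop : Path (⟨_, K.tube_circle_notMem 1⟩ : K.Exterior) ⟨_, K.tube_circle_notMem 1⟩ where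
  toFun s := ⟨K.tube (1, (Circle.exp (2 * Real.pi * s) : ℂ)), K.tube_circle_notMem _⟩
  continuous_toFun := by
    refine Continuous.subtype_mk (K.isOpenEmbedding.continuous.comp ?_) _
    fun_prop
  source' := by simp
  target' := by simp

/-- The knot group, based at a point of the exterior. -/
abbrev group (x₀ : K.Exterior) : Type := FundamentalGroup K.Exterior x₀

/-- A meridian is an element of the knot group obtained by joining the base point to the boundary
of a fibre of the tubular neighbourhood, running once around that boundary, and going back. -/
def IsMeridian {x₀ : K.Exterior} (μ : K.group x₀) : Prop :=
  ∃ a : Path x₀ ⟨_, K.tube_circle_notMem 1⟩,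
    μ = FundamentalGroup.fromPath
      (Path.Homotopic.Quotient.mk ((a.trans K.meridianLoop).trans a.symm))

end Knot

/-! ### The complex Alexander module -/

section Alexander

variable {G : Type} [Group G]

/-- The complex vector space `ℂ ⊗ G'/G''`, where `G'` is the commutator subgroup of `G`.  It is
regarded as a module over Laurent polynomials through conjugation by the element `μ`. -/
def AlexanderModule (_μ : G) : Type :=
  ℂ ⊗[ℤ] Additive (Abelianization (commutator G))

namespace AlexanderModule

instance (μ : G) : AddCommGroup (AlexanderModule μ) :=
  inferInstanceAs (AddCommGroup (ℂ ⊗[ℤ] Additive (Abelianization (commutator G))))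

instance (μ : G) : Module ℂ (AlexanderModule μ) :=
  inferInstanceAs (Module ℂ (ℂ ⊗[ℤ] Additive (Abelianization (commutator G))))

/-- The automorphism of `G'/G''`, written additively, induced by `y ↦ g * y * g⁻¹`. -/
def conj : G →* Module.End ℤ (Additive (Abelianization (commutator G))) where
  toFun g := (MonoidHom.toAdditive
    (MulAut.conjNormal g : MulAut (commutator G)).abelianizationCongr.toMonoidHom).toIntLinearMap
  map_one' := by
    ext y
    induction y using Additive.rec with | _ y =>
    induction y using QuotientGroup.induction_on with | _ y =>
    change Additive.ofMul (Abelianization.of ((MulAut.conjNormal (1 : G)) y)) = _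
    rw [map_one]
    rfl
  map_mul' g h := by
    ext y
    induction y using Additive.rec with | _ y =>
    induction y using QuotientGroup.induction_on with | _ y =>
    change Additive.ofMul (Abelianization.of ((MulAut.conjNormal (g * h : G)) y)) = _
    rw [map_mul]
    rfl

/-- The action of the powers of `t` on `ℂ ⊗ G'/G''`: the generator `t` acts by
`z ⊗ y ↦ z ⊗ (μ * y * μ⁻¹)`. -/
def tAction (μ : G) : Multiplicative ℤ →* Module.End ℂ (AlexanderModule μ) :=
  ((Module.End.baseChangeHom ℤ ℂ (Additive (Abelianization (commutator G)))).toMonoidHom.comp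
    conj).comp (zpowersHom G μ)

instance (μ : G) : Module ℂ[T;T⁻¹] (AlexanderModule μ) :=
  Module.compHom (AlexanderModule μ)
    (AddMonoidAlgebra.lift ℂ (Module.End ℂ (AlexanderModule μ)) ℤ (tAction μ)).toRingHom

/-- The element `z ⊗ y` of the Alexander module. -/
def tmul (μ : G) (z : ℂ) (y : commutator G) : AlexanderModule μ :=
  (z ⊗ₜ[ℤ] Additive.ofMul (Abelianization.of y) :
    ℂ ⊗[ℤ] Additive (Abelianization (commutator G)))

/-- The generator `t` acts on `z ⊗ y` by conjugating `y` with `μ`. -/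
theorem T_smul_tmul (μ : G) (z : ℂ) (y : commutator G) :
    (LaurentPolynomial.T 1 : ℂ[T;T⁻¹]) • tmul μ z y = tmul μ z (MulAut.conjNormal μ y) := by
  change AddMonoidAlgebra.lift ℂ (Module.End ℂ (AlexanderModule μ)) ℤ (tAction μ)
    (AddMonoidAlgebra.single 1 1) (tmul μ z y) = _
  rw [AddMonoidAlgebra.lift_single, one_smul]
  have h : zpowersHom G μ (Multiplicative.ofAdd 1) = μ := by simp
  have h' : tAction μ (Multiplicative.ofAdd 1) =
      Module.End.baseChangeHom ℤ ℂ (Additive (Abelianization (commutator G))) (conj μ) := by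
    change Module.End.baseChangeHom ℤ ℂ (Additive (Abelianization (commutator G)))
      (conj (zpowersHom G μ (Multiplicative.ofAdd 1))) = _
    rw [h]
  rw [h']
  rfl

/-- Constants act through the complex vector space structure. -/
theorem C_smul (μ : G) (c : ℂ) (x : AlexanderModule μ) :
    (LaurentPolynomial.C c : ℂ[T;T⁻¹]) • x = c • x := by
  change AddMonoidAlgebra.lift ℂ (Module.End ℂ (AlexanderModule μ)) ℤ (tAction μ)
    (AddMonoidAlgebra.single 0 c) x = _
  rw [AddMonoidAlgebra.lift_single]
  simp

end AlexanderModule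

/-- The order ideal (zeroth Fitting ideal) of a module: it is generated by the determinants of all
square matrices of relations between the members of a finite generating family. -/
def orderIdeal (R M : Type*) [CommRing R] [AddCommGroup M] [Module R M] : Ideal R :=
  Ideal.span {d | ∃ (n : ℕ) (g : Fin n → M) (A : Matrix (Fin n) (Fin n) R),
    Submodule.span R (Set.range g) = ⊤ ∧ (∀ i, ∑ j, A i j • g j = 0) ∧ d = A.det}

/-- An Alexander polynomial is a generator of the order ideal of the Alexander module. -/
def IsAlexanderPolynomial (μ : G) (Δ : ℂ[T;T⁻¹]) : Prop :=
  Ideal.span {Δ} = orderIdeal ℂ[T;T⁻¹] (AlexanderModule μ)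

/-- `α` is a root of the Laurent polynomial `Δ`. -/
def IsRoot (Δ : ℂ[T;T⁻¹]) (α : ℂˣ) : Prop :=
  LaurentPolynomial.eval₂ (RingHom.id ℂ) α Δ = 0

/-- The cyclic module `Λ / (t - α)^q`, where `Λ = ℂ[t, t⁻¹]`. -/
abbrev Cyclic (α : ℂˣ) (q : ℕ) : Type :=
  ℂ[T;T⁻¹] ⧸ Ideal.span {(LaurentPolynomial.T 1 - LaurentPolynomial.C (α : ℂ)) ^ q}

/-- A decomposition of the Alexander module as a finite direct sum, over the roots `β` of the
Alexander polynomial `Δ`, of modules `Λ / (t - β)^(q β 0) ⊕ ⋯ ⊕ Λ / (t - β)^(q β (k β - 1))`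
with increasingly ordered positive exponents. -/
structure AlexanderDecomposition (μ : G) (Δ : ℂ[T;T⁻¹]) where
  roots : Finset ℂˣ
  mem_roots : ∀ β, β ∈ roots ↔ IsRoot Δ β
  k : ℂˣ → ℕ
  q : (β : ℂˣ) → Fin (k β) → ℕ
  one_le_q : ∀ β i, 1 ≤ q β i
  monotone_q : ∀ β, Monotone (q β)
  iso : AlexanderModule μ ≃ₗ[ℂ[T;T⁻¹]] ⨁ β : roots, ⨁ i : Fin (k β), Cyclic (β : ℂˣ) (q β i)

end Alexander

/-! ### Cocycles and the subspaces `C_n` -/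

section Cocycles

variable {G : Type} [Group G]

/-- The projection of `G` onto the integers (written multiplicatively) given by an identification
of the abelianization with the infinite cyclic group. -/
def proj (ab : Abelianization G ≃* Multiplicative ℤ) : G →* Multiplicative ℤ :=
  ab.toMonoidHom.comp Abelianization.of

/-- The integer `|γ|`. -/
def deg (ab : Abelianization G ≃* Multiplicative ℤ) (γ : G) : ℤ := (proj ab γ).toAdd

/-- The `G`-module `ℂ_α`: the complex numbers, with `γ • z = α ^ |γ| * z`. -/
def twisted (ab : Abelianization G ≃* Multiplicative ℤ) (α : ℂˣ) : Representation ℂ G ℂ :=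
  (algebraMap ℂ (Module.End ℂ ℂ)).toMonoidHom.comp
    ((Units.coeHom ℂ).comp ((zpowersHom ℂˣ α).comp (proj ab)))

theorem twisted_apply (ab : Abelianization G ≃* Multiplicative ℤ) (α : ℂˣ) (γ : G) (z : ℂ) :
    twisted ab α γ z = (α : ℂ) ^ deg ab γ * z := by
  simp [twisted, deg, zpowersHom_apply]

/-- The space of 1-cocycles `Z¹(G, ℂ_α)`. -/
abbrev Z1 (ab : Abelianization G ≃* Multiplicative ℤ) (α : ℂˣ) : Submodule ℂ (G → ℂ) :=
  groupCohomology.cocycles₁ (Rep.of (twisted ab α))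

/-- The space of 1-coboundaries `B¹(G, ℂ_α)`. -/
abbrev B1 (ab : Abelianization G ≃* Multiplicative ℤ) (α : ℂˣ) : Submodule ℂ (G → ℂ) :=
  groupCohomology.coboundaries₁ (Rep.of (twisted ab α))

/-- The unipotent Jordan block of size `m`. -/
def jordanMatrix (m : ℕ) : Matrix (Fin m) (Fin m) ℂ :=
  Matrix.of fun i j => if i = j then 1 else if (i : ℕ) + 1 = j then 1 else 0

theorem jordanMatrix_blockTriangular (m : ℕ) : (jordanMatrix m).BlockTriangular id := by
  intro i j hij
  have h : (j : ℕ) < i := hij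
  have h1 : i ≠ j := by rintro rfl; omega
  have h2 : (i : ℕ) + 1 ≠ j := by omega
  simp [jordanMatrix, h1, h2]

theorem det_jordanMatrix (m : ℕ) : (jordanMatrix m).det = 1 := by
  rw [Matrix.det_of_isUpperTriangular (jordanMatrix_blockTriangular m)]
  simp [jordanMatrix]

/-- The unipotent Jordan block as an invertible matrix. -/
def jordan (m : ℕ) : GL (Fin m) ℂ :=
  Matrix.GeneralLinearGroup.mkOfDetNeZero (jordanMatrix m) (by simp [det_jordanMatrix])

/-- The abelian homomorphism `φ_m : G → GL(m, ℂ)` through which a meridian acts by the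
unipotent Jordan block, i.e. `φ_m γ = J ^ |γ|`. -/
def phi (ab : Abelianization G ≃* Multiplicative ℤ) (m : ℕ) : G →* GL (Fin m) ℂ :=
  (zpowersHom (GL (Fin m) ℂ) (jordan m)).comp (proj ab)

/-- The group `G_n` of invertible upper triangular matrices of size `n`. -/
def upperTriangularGroup (n : ℕ) : Subgroup (GL (Fin n) ℂ) where
  carrier := {A | (A : Matrix (Fin n) (Fin n) ℂ).BlockTriangular id}
  mul_mem' {A B} hA hB := by
    simpa using Matrix.BlockTriangular.mul hA hB
  one_mem' := by
    simpa using Matrix.blockTriangular_one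
  inv_mem' {A} hA := by
    have : Invertible (A : Matrix (Fin n) (Fin n) ℂ) := A.invertible
    simpa using Matrix.blockTriangular_inv_of_blockTriangular hA

/-- The matrix `ρ_n^V(γ)` of size `n = m + 1` with first row `(α ^ |γ|, V(γ))`, zeros below the
upper left entry, and lower right block `φ_m(γ)`. -/
def rhoMatrix (ab : Abelianization G ≃* Multiplicative ℤ) (α : ℂˣ) {m : ℕ} (V : Fin m → G → ℂ)
    (γ : G) : Matrix (Fin (m + 1)) (Fin (m + 1)) ℂ :=
  Matrix.of (Fin.cons (Fin.cons ((α : ℂ) ^ deg ab γ) fun j => V j γ)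
    fun i => Fin.cons 0 fun j => (phi ab m γ : Matrix (Fin m) (Fin m) ℂ) i j)

/-- The map `ρ_n^V` is a homomorphism from `G` to `G_n`, where `n = m + 1`. -/
def IsRhoHom (ab : Abelianization G ≃* Multiplicative ℤ) (α : ℂˣ) {m : ℕ}
    (V : Fin m → G → ℂ) : Prop :=
  ∃ ρ : G →* upperTriangularGroup (m + 1),
    ∀ γ, ((ρ γ : GL (Fin (m + 1)) ℂ) : Matrix (Fin (m + 1)) (Fin (m + 1)) ℂ) = rhoMatrix ab α V γ

/-- The homomorphism property of `ρ_n^V`, in coordinates. -/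
theorem isRhoHom_iff (ab : Abelianization G ≃* Multiplicative ℤ) (α : ℂˣ) {m : ℕ}
    (V : Fin m → G → ℂ) :
    IsRhoHom ab α V ↔ ∀ (γ₁ γ₂ : G) (j : Fin m),
      V j (γ₁ * γ₂) = (α : ℂ) ^ deg ab γ₁ * V j γ₂ +
        ∑ i, V i γ₁ * (phi ab m γ₂ : Matrix (Fin m) (Fin m) ℂ) i j := by
  have hmul : (∀ γ₁ γ₂, rhoMatrix ab α V (γ₁ * γ₂) = rhoMatrix ab α V γ₁ * rhoMatrix ab α V γ₂) ↔
      ∀ (γ₁ γ₂ : G) (j : Fin m), V j (γ₁ * γ₂) = (α : ℂ) ^ deg ab γ₁ * V j γ₂ +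
        ∑ i, V i γ₁ * (phi ab m γ₂ : Matrix (Fin m) (Fin m) ℂ) i j := by
    refine ⟨fun h γ₁ γ₂ j => ?_, fun h γ₁ γ₂ => ?_⟩
    · have := congrFun (congrFun (h γ₁ γ₂) 0) j.succ
      simpa [rhoMatrix, Matrix.mul_apply, Fin.sum_univ_succ] using this
    · have hphi : (phi ab m (γ₁ * γ₂) : Matrix (Fin m) (Fin m) ℂ) =
          (phi ab m γ₁ : Matrix (Fin m) (Fin m) ℂ) * phi ab m γ₂ := by
        rw [map_mul, Units.val_mul]
      ext i j
      refine Fin.cases ?_ (fun i => ?_) i <;> refine Fin.cases ?_ (fun j => ?_) j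
      · simp [rhoMatrix, Matrix.mul_apply, Fin.sum_univ_succ, deg,
          zpow_add₀ (Units.ne_zero α)]
      · simpa [rhoMatrix, Matrix.mul_apply, Fin.sum_univ_succ] using h γ₁ γ₂ j
      · simp [rhoMatrix, Matrix.mul_apply, Fin.sum_univ_succ]
      · simp only [rhoMatrix, Matrix.mul_apply, Fin.sum_univ_succ, Matrix.of_apply, Fin.cons_succ,
          Fin.cons_zero, zero_mul, zero_add]
        rw [hphi, Matrix.mul_apply]
  rw [← hmul]
  constructor
  · rintro ⟨ρ, hρ⟩ γ₁ γ₂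
    rw [← hρ, ← hρ, ← hρ, map_mul]
    simp
  · intro h
    have hJ : jordan m ∈ upperTriangularGroup m := jordanMatrix_blockTriangular m
    have hphi : ∀ γ, (phi ab m γ : Matrix (Fin m) (Fin m) ℂ).BlockTriangular id := fun γ =>
      (upperTriangularGroup m).zpow_mem hJ (proj ab γ).toAdd
    have htri : ∀ γ, (rhoMatrix ab α V γ).BlockTriangular id := by
      intro γ i j hij
      change j < i at hij
      revert hij
      refine Fin.cases ?_ (fun i => ?_) i
      · intro hij
        exact absurd hij (Fin.not_lt_zero j)
      · refine Fin.cases ?_ (fun j => ?_) j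
        · intro _
          simp [rhoMatrix]
        · intro hij
          simpa [rhoMatrix] using hphi γ (Fin.succ_lt_succ_iff.1 hij)
    have hdet : ∀ γ, (rhoMatrix ab α V γ).det ≠ 0 := by
      intro γ
      have hd : (phi ab m γ : Matrix (Fin m) (Fin m) ℂ).det ≠ 0 :=
        ((phi ab m γ).isUnit.map Matrix.detMonoidHom).ne_zero
      rw [Matrix.det_of_isUpperTriangular (hphi γ)] at hd
      rw [Matrix.det_of_isUpperTriangular (htri γ), Fin.prod_univ_succ]
      refine mul_ne_zero ?_ ?_
      · simpa [rhoMatrix] using zpow_ne_zero _ (Units.ne_zero α)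
      · simpa [rhoMatrix] using hd
    refine ⟨MonoidHom.mk' (fun γ => ⟨Matrix.GeneralLinearGroup.mkOfDetNeZero _ (hdet γ), htri γ⟩)
      fun γ₁ γ₂ => Subtype.ext (Units.ext (h γ₁ γ₂)), fun γ => rfl⟩

/-- The subspace `C_n` of `Z¹(G, ℂ_α)`, for `n ≥ 2`: the cocycles `U` for which there are cochains
`v_2, …, v_{n-1}` such that `ρ_n^{(U, v_2, …, v_{n-1})}` is a homomorphism to `G_n`. -/
def C (ab : Abelianization G ≃* Multiplicative ℤ) (α : ℂˣ) (n : ℕ) : Submodule ℂ (G → ℂ) where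
  carrier := {U | U ∈ Z1 ab α ∧ ∃ v : Fin (n - 2) → G → ℂ,
    IsRhoHom ab α (Fin.cons U v : Fin (n - 2 + 1) → G → ℂ)}
  zero_mem' := by
    refine ⟨zero_mem _, 0, (isRhoHom_iff ab α _).2 fun γ₁ γ₂ j => ?_⟩
    have h : (Fin.cons 0 0 : Fin (n - 2 + 1) → G → ℂ) = 0 := by
      funext i; refine Fin.cases ?_ (fun i => ?_) i <;> simp
    simp [h]
  add_mem' {U U'} hU hU' := by
    obtain ⟨hU, v, hv⟩ := hU
    obtain ⟨hU', v', hv'⟩ := hU'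
    refine ⟨add_mem hU hU', v + v', (isRhoHom_iff ab α _).2 fun γ₁ γ₂ j => ?_⟩
    have h : (Fin.cons (U + U') (v + v') : Fin (n - 2 + 1) → G → ℂ) =
        Fin.cons U v + Fin.cons U' v' := by
      funext i; refine Fin.cases ?_ (fun i => ?_) i <;> simp
    rw [h]
    simp only [Pi.add_apply, (isRhoHom_iff ab α _).1 hv γ₁ γ₂ j,
      (isRhoHom_iff ab α _).1 hv' γ₁ γ₂ j, add_mul, Finset.sum_add_distrib]
    ring
  smul_mem' c U hU := by
    obtain ⟨hU, v, hv⟩ := hU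
    refine ⟨Submodule.smul_mem _ c hU, c • v, (isRhoHom_iff ab α _).2 fun γ₁ γ₂ j => ?_⟩
    have h : (Fin.cons (c • U) (c • v) : Fin (n - 2 + 1) → G → ℂ) =
        c • (Fin.cons U v : Fin (n - 2 + 1) → G → ℂ) := by
      funext i; refine Fin.cases ?_ (fun i => ?_) i <;> simp
    rw [h]
    simp only [Pi.smul_apply, smul_eq_mul, (isRhoHom_iff ab α _).1 hv γ₁ γ₂ j, mul_add,
      Finset.mul_sum, mul_assoc]
    ring_nf

end Cocycles

end KnotModule

end

noncomputable section

namespace KnotModule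

/-! ### Degrees and the splitting of the projection to the integers -/

section Degree

variable {G : Type} [Group G] (ab : Abelianization G ≃* Multiplicative ℤ)

/-! On the commutator subgroup both `α ^ |γ|` and `φ(γ)` are trivial, so every first-row entry `V j`
of a homomorphism is additive there and induces a functional `h_j` on the Alexander module.
Comparing `(μyμ⁻¹)μ` with `μy` gives `V(μyμ⁻¹) J = α V(y)`. Read entrywise, `h_0(t x) = α h_0(x)`
and `h_{j+1}((t - α) x) = -h_j(t x)`, hence `h_j((t - α)^j x) = (-α)^j h_0(x)`
(`IsRhoHom.functional_pow`). A row of length `m + 1` therefore forces `h_0` to vanish on the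
generator of every summand `Λ/(t - α)^q` with `q ≤ m`.

Conversely, if `q ≥ m + 1`, then `t ↦ α J⁻¹` makes `Λ/(t - α)^q` act on rows of length `m + 1`,
because `J - 1` is nilpotent. The top row of this action, multiplied by `φ`, extends the cocycle
dual to the generator (`functionalCocycle_dual_mem_C`).

An `α`-eigenfunctional is determined by its values on the generators of the `α`-summands, and a
cocycle by its eigenfunctional and its value at `μ`. So `C_{m+2}` has as basis one coboundary
together with the dual cocycles of the summands with `q_i ≥ m + 1` (`C_eq_span`,
`linearIndependent_cocycleBasis`), and all assertions become counts of exponents. Two facts support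
this: `k_α > 0`, from a diagonal relation matrix (`k_pos`), and `α ≠ 1` (`root_ne_one`), which makes
the coboundary nonzero at `μ`. -/

theorem deg_mul (a b : G) : deg ab (a * b) = deg ab a + deg ab b := by simp [deg]

theorem deg_zpow (a : G) (k : ℤ) : deg ab (a ^ k) = k * deg ab a := by simp [deg]

theorem deg_eq_zero_iff (a : G) : deg ab a = 0 ↔ a ∈ commutator G := by
  rw [← Abelianization.ker_of G, MonoidHom.mem_ker]
  change Multiplicative.toAdd (ab (Abelianization.of a)) = 0 ↔ _
  rw [toAdd_eq_zero, map_eq_one_iff _ ab.injective]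

theorem deg_coe (y : commutator G) : deg ab (y : G) = 0 := (deg_eq_zero_iff ab _).2 y.2

variable {μ : G} (hμ : deg ab μ = 1)

/-- The component in the commutator subgroup of an element `γ`, relative to the splitting
`k ↦ μ ^ k` of the projection to the integers. -/
def commPart (γ : G) : commutator G :=
  ⟨γ * μ ^ (-deg ab γ), by
    rw [← deg_eq_zero_iff ab, deg_mul, deg_zpow, hμ]
    ring⟩

/-- Moving `μ ^ |a|` past the commutator part of `b` conjugates it; on the Alexander module this
becomes the action of `t ^ |a|`. -/
theorem commPart_mul (a b : G) : commPart ab hμ (a * b) =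
    commPart ab hμ a * MulAut.conjNormal (μ ^ deg ab a) (commPart ab hμ b) := by
  apply Subtype.ext
  simp only [commPart, Subgroup.coe_mul, MulAut.conjNormal_apply, deg_mul, neg_add, zpow_add,
    zpow_neg]
  group

theorem commPart_coe (y : commutator G) : commPart ab hμ (y : G) = y := by
  apply Subtype.ext
  simp [commPart, deg_coe]

theorem commPart_self : commPart ab hμ μ = 1 := by
  apply Subtype.ext
  simp [commPart, hμ]

end Degree

/-! ### Linear maps on the Alexander module -/

namespace AlexanderModule

variable {G : Type} [Group G] {μ : G}

theorem tmul_mul (z : ℂ) (x y : commutator G) :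
    tmul μ z (x * y) = tmul μ z x + tmul μ z y := by
  simp only [tmul, map_mul, ofMul_mul]
  exact TensorProduct.tmul_add _ _ _

theorem tmul_one (z : ℂ) : tmul μ z 1 = 0 := by
  simpa using tmul_mul (μ := μ) z 1 1

theorem smul_tmul (c z : ℂ) (y : commutator G) : c • tmul μ z y = tmul μ (c * z) y := rfl

theorem T_smul_tmul_zpow (k : ℤ) (z : ℂ) (y : commutator G) :
    (LaurentPolynomial.T k : ℂ[T;T⁻¹]) • tmul μ z y =
      tmul μ z (MulAut.conjNormal (μ ^ k) y) := by
  change AddMonoidAlgebra.lift ℂ (Module.End ℂ (AlexanderModule μ)) ℤ (tAction μ)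
    (AddMonoidAlgebra.single k 1) (tmul μ z y) = _
  rw [AddMonoidAlgebra.lift_single, one_smul]
  have h' : tAction μ (Multiplicative.ofAdd k) =
      Module.End.baseChangeHom ℤ ℂ (Additive (Abelianization (commutator G))) (conj (μ ^ k)) := by
    change Module.End.baseChangeHom ℤ ℂ (Additive (Abelianization (commutator G)))
      (conj (zpowersHom G μ (Multiplicative.ofAdd k))) = _
    rw [zpowersHom_apply, toAdd_ofAdd]
  rw [h']
  rfl

@[elab_as_elim]
theorem induction {p : AlexanderModule μ → Prop} (x : AlexanderModule μ)
    (tmul : ∀ z y, p (tmul μ z y)) (add : ∀ x y, p x → p y → p (x + y)) : p x := by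
  refine TensorProduct.induction_on (motive := p) x ?_ ?_ add
  · have := tmul 0 1
    rwa [tmul_one] at this
  · intro z y
    induction y using Additive.rec with | _ y =>
    induction y using QuotientGroup.induction_on with | _ y =>
    exact tmul z y

/-- The linear functional on the Alexander module extending an additive function on the
commutator subgroup. -/
def extend (μ : G) (u : commutator G → ℂ) (hu : ∀ x y, u (x * y) = u x + u y) :
    AlexanderModule μ →ₗ[ℂ] ℂ :=
  LinearMap.liftBaseChange ℂ (MonoidHom.toAdditiveLeft (Abelianization.lift
    (MonoidHom.mk' (fun y => Multiplicative.ofAdd (u y)) fun x y =>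
      congrArg Multiplicative.ofAdd (hu x y)))).toIntLinearMap

theorem extend_tmul (u : commutator G → ℂ) (hu : ∀ x y, u (x * y) = u x + u y) (z : ℂ)
    (y : commutator G) : extend μ u hu (tmul μ z y) = z * u y := rfl

/-- Linear functionals on which `t` acts as multiplication by `α`. -/
def IsEigen (α : ℂˣ) (h : AlexanderModule μ →ₗ[ℂ] ℂ) : Prop :=
  ∀ y, h ((LaurentPolynomial.T 1 : ℂ[T;T⁻¹]) • y) = α * h y

theorem IsEigen.T_smul {α : ℂˣ} {h : AlexanderModule μ →ₗ[ℂ] ℂ} (hh : IsEigen α h) (k : ℤ)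
    (y : AlexanderModule μ) :
    h ((LaurentPolynomial.T k : ℂ[T;T⁻¹]) • y) = (α : ℂ) ^ k * h y := by
  induction k using Int.induction_on generalizing y with
  | zero => simp
  | succ k ih =>
    rw [LaurentPolynomial.T_add, mul_smul, ih, hh, zpow_add_one₀ α.ne_zero, mul_assoc]
  | pred k ih =>
    have h1 := hh ((LaurentPolynomial.T (-1) : ℂ[T;T⁻¹]) • y)
    rw [← mul_smul, ← LaurentPolynomial.T_add, add_neg_cancel, LaurentPolynomial.T_zero,
      one_smul] at h1
    rw [LaurentPolynomial.T_sub, mul_smul, ih, zpow_sub_one₀ α.ne_zero, h1]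
    field_simp

/-- An eigenfunctional is `Λ`-linear once `ℂ` is made a `Λ`-module by evaluation at `α`. -/
theorem IsEigen.smul {α : ℂˣ} {h : AlexanderModule μ →ₗ[ℂ] ℂ} (hh : IsEigen α h) (r : ℂ[T;T⁻¹])
    (y : AlexanderModule μ) :
    h (r • y) = LaurentPolynomial.eval₂ (RingHom.id ℂ) α r * h y := by
  induction r using LaurentPolynomial.induction_on' with
  | add p q hp hq => rw [add_smul, map_add, hp, hq, map_add, add_mul]
  | C_mul_T n a =>
    rw [mul_smul, C_smul, map_smul, hh.T_smul]
    simp [mul_assoc]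

theorem IsEigen.extend {α : ℂˣ} (u : commutator G → ℂ) (hu : ∀ x y, u (x * y) = u x + u y)
    (h : ∀ y, u (MulAut.conjNormal μ y) = α * u y) : IsEigen α (extend μ u hu) := by
  intro y
  induction y using induction with
  | tmul z y =>
    rw [T_smul_tmul, extend_tmul, extend_tmul, h]
    ring
  | add x y hx hy => rw [smul_add, map_add, map_add, hx, hy, mul_add]

theorem hom_ext {h h' : AlexanderModule μ →ₗ[ℂ] ℂ} (hh : ∀ y, h (tmul μ 1 y) = h' (tmul μ 1 y)) :
    h = h' := by
  ext x
  induction x using induction with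
  | tmul z y =>
    have : tmul μ z y = z • tmul μ 1 y := by rw [smul_tmul, mul_one]
    rw [this, map_smul, map_smul, hh]
  | add x y hx hy => rw [map_add, map_add, hx, hy]

end AlexanderModule

/-! ### Jordan blocks -/

section Jordan

/-- Cayley–Hamilton: the characteristic polynomial is `(X - 1)^m`. -/
theorem jordanMatrix_sub_one_pow (m : ℕ) : (jordanMatrix m - 1) ^ m = 0 := by
  have h := Matrix.aeval_self_charpoly (jordanMatrix m)
  rw [Matrix.charpoly_of_isUpperTriangular _ (jordanMatrix_blockTriangular m)] at h
  simpa [jordanMatrix] using h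

theorem val_jordan (m : ℕ) : (jordan m : Matrix (Fin m) (Fin m) ℂ) = jordanMatrix m := rfl

theorem jordan_mulVec (m : ℕ) :
    (jordan (m + 1) : Matrix (Fin (m + 1)) (Fin (m + 1)) ℂ).mulVec (Pi.single 0 1) = Pi.single 0 1 := by
  ext i
  simp only [val_jordan, Matrix.mulVec_single_one, Matrix.col_apply, jordanMatrix, Matrix.of_apply,
    Pi.single_apply]
  simp

/-- The first column of every power of `J` is the first basis vector, so right multiplication by `J
^ k` leaves the leading entry of a row unchanged. -/
theorem jordan_zpow_mulVec (m : ℕ) (k : ℤ) :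
    ((jordan (m + 1) ^ k : GL (Fin (m + 1)) ℂ) : Matrix (Fin (m + 1)) (Fin (m + 1)) ℂ).mulVec
      (Pi.single 0 1) = Pi.single 0 1 := by
  induction k using Int.induction_on with
  | zero => rw [zpow_zero, Units.val_one, Matrix.one_mulVec]
  | succ k ih =>
    rw [zpow_add_one, Units.val_mul, ← Matrix.mulVec_mulVec, jordan_mulVec, ih]
  | pred k ih =>
    have h := congrArg
      ((jordan (m + 1))⁻¹ : GL (Fin (m + 1)) ℂ).val.mulVec (jordan_mulVec m)
    rw [Matrix.mulVec_mulVec, Units.inv_mul, Matrix.one_mulVec] at h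
    rw [zpow_sub_one, Units.val_mul, ← Matrix.mulVec_mulVec, ← h, ih]

variable {G : Type} [Group G] (ab : Abelianization G ≃* Multiplicative ℤ)

theorem phi_apply (m : ℕ) (γ : G) : phi ab m γ = jordan m ^ deg ab γ := rfl

theorem phi_col_zero (m : ℕ) (γ : G) (i : Fin (m + 1)) :
    (phi ab (m + 1) γ : Matrix (Fin (m + 1)) (Fin (m + 1)) ℂ) i 0 = if i = 0 then 1 else 0 := by
  have h := congrFun (jordan_zpow_mulVec m (deg ab γ)) i
  rw [Matrix.mulVec_single_one, Pi.single_apply] at h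
  exact h

theorem sum_mul_jordanMatrix_succ {m : ℕ} (a : Fin (m + 1) → ℂ) (j : Fin m) :
    ∑ i, a i * jordanMatrix (m + 1) i j.succ = a j.succ + a j.castSucc := by
  have h : ∀ i, a i * jordanMatrix (m + 1) i j.succ =
      (if i = j.succ then a i else 0) + if i = j.castSucc then a i else 0 := by
    intro i
    by_cases h1 : i = j.succ
    · subst h1
      simp [jordanMatrix, Fin.ext_iff]
    · by_cases h2 : i = j.castSucc
      · subst h2
        simp [jordanMatrix, Fin.ext_iff]
      · have h3 : (i : ℕ) ≠ j := fun h => h2 (Fin.ext h)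
        simp [jordanMatrix, h1, h2, h3]
  simp [h, Finset.sum_add_distrib]

/-- The representation of Laurent polynomials on row vectors of length `m` in which `t` acts as
`α` times the inverse of the Jordan block. -/
def jordanEval (α : ℂˣ) (m : ℕ) : ℂ[T;T⁻¹] →ₐ[ℂ] Matrix (Fin m) (Fin m) ℂ :=
  AddMonoidAlgebra.lift ℂ _ ℤ ((Units.coeHom _).comp (zpowersHom (GL (Fin m) ℂ)
    (Units.map (algebraMap ℂ (Matrix (Fin m) (Fin m) ℂ)).toMonoidHom α * (jordan m)⁻¹)))

theorem jordanEval_T (α : ℂˣ) (m : ℕ) (k : ℤ) :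
    jordanEval α m (LaurentPolynomial.T k) =
      (α : ℂ) ^ k • (((jordan m ^ k)⁻¹ : GL (Fin m) ℂ) : Matrix (Fin m) (Fin m) ℂ) := by
  have hc : Commute (Units.map (algebraMap ℂ (Matrix (Fin m) (Fin m) ℂ)).toMonoidHom α)
      (jordan m)⁻¹ := by
    apply Units.ext
    exact Algebra.commutes _ _
  rw [jordanEval, LaurentPolynomial.T, AddMonoidAlgebra.lift_single, one_smul]
  change (((_ * _) ^ k : GL (Fin m) ℂ) : Matrix (Fin m) (Fin m) ℂ) = _
  rw [hc.mul_zpow, ← map_zpow, inv_zpow, Units.val_mul, Algebra.smul_def]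
  congr 1
  change algebraMap ℂ (Matrix (Fin m) (Fin m) ℂ) ((α ^ k : ℂˣ) : ℂ) = _
  rw [Units.val_zpow_eq_zpow_val]

theorem jordanEval_C (α : ℂˣ) (m : ℕ) (c : ℂ) :
    jordanEval α m (LaurentPolynomial.C c) = algebraMap ℂ _ c :=
  (jordanEval α m).commutes c

/-- The image of `t - α` is `α (J⁻¹ - 1) = -α J⁻¹ (J - 1)`, a product of commuting factors the
second of which has vanishing `m`-th power. -/
theorem jordanEval_pow_eq_zero (α : ℂˣ) {m q : ℕ} (h : m ≤ q) :
    jordanEval α m ((LaurentPolynomial.T 1 - LaurentPolynomial.C (α : ℂ)) ^ q) = 0 := by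
  have h1 : jordanEval α m (LaurentPolynomial.T 1 - LaurentPolynomial.C (α : ℂ)) =
      -(jordanEval α m (LaurentPolynomial.T 1) * (jordanMatrix m - 1)) := by
    rw [map_sub, jordanEval_C, jordanEval_T, zpow_one, zpow_one, mul_sub, mul_one, smul_mul_assoc,
      ← val_jordan, Units.inv_mul, Algebra.algebraMap_eq_smul_one]
    abel
  have hc : Commute (jordanEval α m (LaurentPolynomial.T 1)) (jordanMatrix m - 1) := by
    rw [jordanEval_T, zpow_one, zpow_one]
    refine Commute.smul_left (Commute.sub_right ?_ (Commute.one_right _)) _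
    rw [← val_jordan]
    exact (Commute.refl (jordan m)).inv_left.map (Units.coeHom _)
  rw [map_pow, h1, neg_pow, hc.mul_pow, pow_eq_zero_of_le h (jordanMatrix_sub_one_pow m), mul_zero,
    mul_zero]

/-- The action of the cyclic module `Λ / (t - α)^q` on row vectors of length `m ≤ q`. -/
def cyclicEval (α : ℂˣ) {m q : ℕ} (h : m ≤ q) : Cyclic α q →+* Matrix (Fin m) (Fin m) ℂ :=
  Ideal.Quotient.lift _ (jordanEval α m).toRingHom fun a ha => by
    obtain ⟨b, rfl⟩ := Ideal.mem_span_singleton.1 ha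
    rw [map_mul]
    simp only [AlgHom.toRingHom_eq_coe, RingHom.coe_coe, jordanEval_pow_eq_zero α h, zero_mul]

theorem cyclicEval_smul (α : ℂˣ) {m q : ℕ} (h : m ≤ q) (r : ℂ[T;T⁻¹]) (x : Cyclic α q) :
    cyclicEval α h (r • x) = cyclicEval α h x * jordanEval α m r := by
  obtain ⟨x, rfl⟩ := Ideal.Quotient.mk_surjective x
  change cyclicEval α h (Ideal.Quotient.mk _ (r * x)) = _
  rw [mul_comm, map_mul, map_mul]
  rfl

end Jordan

end KnotModule

end

noncomputable section

namespace KnotModule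

variable {G : Type} [Group G] {μ : G} {Δ : ℂ[T;T⁻¹]}

/-! ### Generators and coordinates of a decomposed Alexander module -/

namespace AlexanderDecomposition

variable (D : AlexanderDecomposition μ Δ)

open Classical in
/-- The generator of a cyclic summand. -/
def gen (β : D.roots) (i : Fin (D.k β)) : AlexanderModule μ :=
  D.iso.symm (DirectSum.lof ℂ[T;T⁻¹] _ (fun β : D.roots => ⨁ i : Fin (D.k β), Cyclic β (D.q β i)) β
    (DirectSum.lof ℂ[T;T⁻¹] _ (fun i : Fin (D.k β) => Cyclic β (D.q β i)) i 1))

theorem pow_smul_gen (β : D.roots) (i : Fin (D.k β)) :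
    ((LaurentPolynomial.T 1 - LaurentPolynomial.C ((β : ℂˣ) : ℂ)) ^ D.q β i : ℂ[T;T⁻¹]) • D.gen β i
      = 0 := by
  have h : ((LaurentPolynomial.T 1 - LaurentPolynomial.C ((β : ℂˣ) : ℂ)) ^ D.q β i : ℂ[T;T⁻¹]) •
      (1 : Cyclic β (D.q β i)) = 0 := by
    change Ideal.Quotient.mk _ (_ * 1) = 0
    rw [mul_one]
    exact Ideal.Quotient.eq_zero_iff_mem.2 (Ideal.mem_span_singleton_self _)
  rw [gen, ← map_smul, ← map_smul, ← map_smul, h, map_zero, map_zero, map_zero]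

theorem span_range_gen :
    Submodule.span ℂ[T;T⁻¹] (Set.range fun s : Σ β : D.roots, Fin (D.k β) => D.gen s.1 s.2)
      = ⊤ := by
  classical
  rw [eq_top_iff]
  rintro x -
  obtain ⟨x, rfl⟩ := D.iso.symm.surjective x
  induction x using DirectSum.induction_on with
  | zero => rw [map_zero]; exact zero_mem _
  | add x y hx hy => rw [map_add]; exact add_mem hx hy
  | of β x =>
    induction x using DirectSum.induction_on with
    | zero => rw [map_zero, map_zero]; exact zero_mem _
    | add x y hx hy => rw [map_add, map_add]; exact add_mem hx hy
    | of i x =>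
      obtain ⟨r, rfl⟩ : ∃ r, Ideal.Quotient.mk (Ideal.span
          {(LaurentPolynomial.T 1 - LaurentPolynomial.C ((β : ℂˣ) : ℂ)) ^ D.q β i}) r = x :=
        Ideal.Quotient.mk_surjective x
      have h : r • D.gen β i ∈ Submodule.span ℂ[T;T⁻¹]
          (Set.range fun s : Σ β : D.roots, Fin (D.k β) => D.gen s.1 s.2) :=
        Submodule.smul_mem _ _ (Submodule.subset_span ⟨⟨β, i⟩, rfl⟩)
      have hr : r • (1 : Cyclic β (D.q β i)) = Ideal.Quotient.mk _ r :=
        congrArg (Ideal.Quotient.mk (Ideal.span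
          {(LaurentPolynomial.T 1 - LaurentPolynomial.C ((β : ℂˣ) : ℂ)) ^ D.q β i})) (mul_one r)
      rw [gen, ← map_smul, ← map_smul, ← map_smul, hr] at h
      exact h

/-- The coordinate of an element in a cyclic summand. -/
def coord (β : D.roots) (i : Fin (D.k β)) :
    AlexanderModule μ →ₗ[ℂ[T;T⁻¹]] Cyclic β (D.q β i) :=
  DirectSum.component ℂ[T;T⁻¹] _ (fun i : Fin (D.k β) => Cyclic β (D.q β i)) i ∘ₗ
    DirectSum.component ℂ[T;T⁻¹] _ (fun β : D.roots => ⨁ i : Fin (D.k β), Cyclic β (D.q β i)) β ∘ₗ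
      D.iso.toLinearMap

theorem coord_gen_self (β : D.roots) (i : Fin (D.k β)) : D.coord β i (D.gen β i) = 1 := by
  simp [coord, gen, DirectSum.component.lof_self]

theorem coord_gen_of_ne (β : D.roots) {i j : Fin (D.k β)} (h : j ≠ i) :
    D.coord β i (D.gen β j) = 0 := by
  simp [coord, gen, DirectSum.component.lof_self, DirectSum.component.of, h]

/-! ### Eigenfunctionals -/

/-- Applying the functional to the relation `(t - β)^q • g = 0` yields `(α - β)^q h(g) = 0`. -/
theorem isEigen_gen_eq_zero {α : ℂˣ} {h : AlexanderModule μ →ₗ[ℂ] ℂ}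
    (hh : AlexanderModule.IsEigen α h) (β : D.roots) (hβ : (β : ℂˣ) ≠ α) (i : Fin (D.k β)) :
    h (D.gen β i) = 0 := by
  have h1 := hh.smul ((LaurentPolynomial.T 1 - LaurentPolynomial.C ((β : ℂˣ) : ℂ)) ^ D.q β i) (D.gen β i)
  rw [D.pow_smul_gen, map_zero] at h1
  have h2 : (α : ℂ) - (β : ℂˣ) ≠ 0 := sub_ne_zero.2 fun h => hβ (Units.ext h.symm)
  simpa [h2] using h1

theorem isEigen_ext (α : D.roots) {h h' : AlexanderModule μ →ₗ[ℂ] ℂ}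
    (hh : AlexanderModule.IsEigen (α : ℂˣ) h) (hh' : AlexanderModule.IsEigen (α : ℂˣ) h')
    (heq : ∀ i, h (D.gen α i) = h' (D.gen α i)) : h = h' := by
  ext x
  have hx : x ∈ Submodule.span ℂ[T;T⁻¹]
      (Set.range fun s : Σ β : D.roots, Fin (D.k β) => D.gen s.1 s.2) := by
    rw [D.span_range_gen]; trivial
  induction hx using Submodule.span_induction with
  | mem x hx =>
    obtain ⟨⟨β, i⟩, rfl⟩ := hx
    by_cases hβ : β = α
    · subst hβ
      exact heq i
    · have hβ' : (β : ℂˣ) ≠ α := fun h => hβ (Subtype.ext h)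
      simp only [D.isEigen_gen_eq_zero hh β hβ', D.isEigen_gen_eq_zero hh' β hβ']
  | zero => simp
  | add x y _ _ hx hy => rw [map_add, map_add, hx, hy]
  | smul r x _ hx => rw [hh.smul, hh'.smul, hx]

/-- The action of the `i`-th coordinate for the eigenvalue `α` on row vectors of length `m`. -/
def coordEval (α : D.roots) (i : Fin (D.k α)) {m : ℕ} (hm : m ≤ D.q α i) :
    AlexanderModule μ →+ Matrix (Fin m) (Fin m) ℂ :=
  (cyclicEval (α : ℂˣ) hm).toAddMonoidHom.comp (D.coord α i).toAddMonoidHom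

variable (α : D.roots) (i : Fin (D.k α))

theorem coordEval_smul {m : ℕ} (hm : m ≤ D.q α i) (r : ℂ[T;T⁻¹])
    (x : AlexanderModule μ) : D.coordEval α i hm (r • x) =
      D.coordEval α i hm x * jordanEval (α : ℂˣ) m r := by
  simp only [coordEval, AddMonoidHom.comp_apply, LinearMap.toAddMonoidHom_coe, map_smul]
  exact cyclicEval_smul _ hm _ _

theorem coordEval_gen_self {m : ℕ} (hm : m ≤ D.q α i) : D.coordEval α i hm (D.gen α i) = 1 := by
  simp only [coordEval, AddMonoidHom.comp_apply, LinearMap.toAddMonoidHom_coe, coord_gen_self]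
  exact map_one (cyclicEval (α : ℂˣ) hm)

theorem coordEval_gen_of_ne {m : ℕ} (hm : m ≤ D.q α i) {j : Fin (D.k α)} (h : j ≠ i) :
    D.coordEval α i hm (D.gen α j) = 0 := by
  simp only [coordEval, AddMonoidHom.comp_apply, LinearMap.toAddMonoidHom_coe,
    D.coord_gen_of_ne α h, map_zero]

/-- The upper left entry of the action of the `i`-th coordinate. -/
def corner {m : ℕ} (hm : m + 1 ≤ D.q α i) : AlexanderModule μ →ₗ[ℂ] ℂ where
  toFun x := D.coordEval α i hm x 0 0
  map_add' x y := by rw [map_add, Matrix.add_apply]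
  map_smul' c x := by
    rw [← AlexanderModule.C_smul, coordEval_smul, jordanEval_C, ← Algebra.commutes,
      ← Algebra.smul_def]
    rfl

theorem corner_isEigen {m : ℕ} (hm : m + 1 ≤ D.q α i) :
    AlexanderModule.IsEigen (α : ℂˣ) (D.corner α i hm) := by
  intro x
  change D.coordEval α i hm _ 0 0 = _ * D.coordEval α i hm x 0 0
  have h : ∀ l, (((jordan (m + 1))⁻¹ : GL (Fin (m + 1)) ℂ) :
      Matrix (Fin (m + 1)) (Fin (m + 1)) ℂ) l 0 = if l = 0 then 1 else 0 := fun l => by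
    rw [← Pi.single_apply, ← jordan_zpow_mulVec m (-1), zpow_neg_one, Matrix.mulVec_single_one]
    rfl
  rw [coordEval_smul, jordanEval_T, zpow_one, zpow_one, mul_smul_comm, Matrix.smul_apply,
    Matrix.mul_apply]
  simp only [h, mul_ite, mul_one, mul_zero, Finset.sum_ite_eq', Finset.mem_univ, if_true,
    smul_eq_mul]

theorem corner_gen {m : ℕ} (hm : m + 1 ≤ D.q α i) (j : Fin (D.k α)) :
    D.corner α i hm (D.gen α j) = if j = i then 1 else 0 := by
  change D.coordEval α i hm _ 0 0 = _
  split_ifs with h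
  · rw [h, coordEval_gen_self, Matrix.one_apply_eq]
  · rw [D.coordEval_gen_of_ne α i hm h, Matrix.zero_apply]

/-- The eigenfunctional which is one on the `i`-th generator and zero on the others. -/
def dual : AlexanderModule μ →ₗ[ℂ] ℂ := D.corner α i (m := 0) (D.one_le_q α i)

/-- Both sides are eigenfunctionals with the same values on generators. Thus one functional is the
leading entry for rows of every admissible length. -/
theorem corner_eq_dual {m : ℕ} (hm : m + 1 ≤ D.q α i) : D.corner α i hm = D.dual α i :=
  D.isEigen_ext α (D.corner_isEigen α i hm) (D.corner_isEigen α i _) fun j => by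
    rw [dual, corner_gen, corner_gen]

theorem dual_isEigen : AlexanderModule.IsEigen (α : ℂˣ) (D.dual α i) := D.corner_isEigen α i _

theorem dual_gen (j : Fin (D.k α)) : D.dual α i (D.gen α j) = if j = i then 1 else 0 :=
  D.corner_gen α i _ j

theorem isEigen_eq_sum {h : AlexanderModule μ →ₗ[ℂ] ℂ} (hh : AlexanderModule.IsEigen (α : ℂˣ) h) :
    h = ∑ i, h (D.gen α i) • D.dual α i := by
  refine D.isEigen_ext α hh (fun x => ?_) fun j => ?_
  · simp only [LinearMap.sum_apply, LinearMap.smul_apply, D.dual_isEigen α _ x, smul_eq_mul,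
      Finset.mul_sum]
    exact Finset.sum_congr rfl fun _ _ => by ring
  · simp [LinearMap.sum_apply, dual_gen]

/-- Every root of the Alexander polynomial occurs in the decomposition. -/
theorem k_pos (hΔ : IsAlexanderPolynomial μ Δ) : 0 < D.k α := by
  classical
  by_contra hk
  let e := Fintype.equivFin (Σ β : D.roots, Fin (D.k β))
  -- The decomposition has a diagonal relation matrix. Its determinant `∏ (t - β)^q` is a multiple
  -- of `Δ`, hence vanishes at `α`, although by assumption no factor has `β = α`.
  let A : Matrix (Fin (Fintype.card (Σ β : D.roots, Fin (D.k β)))) (Fin _) ℂ[T;T⁻¹] :=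
    Matrix.diagonal fun n => (LaurentPolynomial.T 1 -
      LaurentPolynomial.C (((e.symm n).1 : ℂˣ) : ℂ)) ^ D.q _ (e.symm n).2
  have hA : A.det ∈ Ideal.span {Δ} := by
    rw [hΔ]
    refine Ideal.subset_span ⟨_, fun n => D.gen (e.symm n).1 (e.symm n).2, A, ?_, fun n => ?_, rfl⟩
    · rw [← D.span_range_gen]
      congr 1
      exact e.symm.surjective.range_comp fun s => D.gen s.1 s.2
    · rw [Finset.sum_eq_single n]
      · simp only [A, Matrix.diagonal_apply_eq, pow_smul_gen]
      · intro j _ hj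
        simp only [A, Matrix.diagonal_apply_ne _ hj.symm, zero_smul]
      · simp
  obtain ⟨b, hb⟩ := Ideal.mem_span_singleton.1 hA
  have hroot : LaurentPolynomial.eval₂ (RingHom.id ℂ) (α : ℂˣ) Δ = 0 := (D.mem_roots α).1 α.2
  have h0 := congrArg (LaurentPolynomial.eval₂ (RingHom.id ℂ) (α : ℂˣ)) hb
  rw [map_mul, hroot, zero_mul, Matrix.det_diagonal, map_prod, Finset.prod_eq_zero_iff] at h0
  obtain ⟨n, -, hn⟩ := h0
  have hne : (α : ℂˣ) ≠ (e.symm n).1 := by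
    intro h
    have : α = (e.symm n).1 := Subtype.ext h
    have h2 := (e.symm n).2
    rw [← this] at h2
    exact hk h2.pos
  have h2 : ((α : ℂˣ) : ℂ) - ((e.symm n).1 : ℂˣ) ≠ 0 := sub_ne_zero.2 fun h => hne (Units.ext h)
  rw [map_pow] at hn
  have h3 := eq_zero_of_pow_eq_zero hn
  simp [h2] at h3

end AlexanderDecomposition

end KnotModule

end

noncomputable section

namespace KnotModule

variable {G : Type} [Group G]

/-! ### Cocycles -/

section Cocycles

variable {ab : Abelianization G ≃* Multiplicative ℤ} {α : ℂˣ}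

theorem mem_Z1_iff (U : G → ℂ) :
    U ∈ Z1 ab α ↔ ∀ a b, U (a * b) = (α : ℂ) ^ deg ab a * U b + U a := by
  refine (groupCohomology.mem_cocycles₁_iff (A := Rep.of (twisted ab α)) U).trans ?_
  refine forall_congr' fun a => forall_congr' fun b => ?_
  rw [← twisted_apply]

theorem IsRhoHom.zero_mem_Z1 {m : ℕ} {V : Fin (m + 1) → G → ℂ} (hV : IsRhoHom ab α V) :
    V 0 ∈ Z1 ab α := by
  rw [mem_Z1_iff]
  intro a b
  rw [(isRhoHom_iff ab α V).1 hV a b 0]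
  simp [phi_col_zero]

/-- Writing the index as `m + 2` removes the truncated subtraction in `C`; the cocycle condition is
dropped because the leading entry of a row satisfies it automatically. -/
theorem mem_C_iff (m : ℕ) (U : G → ℂ) :
    U ∈ C ab α (m + 2) ↔ ∃ V : Fin (m + 1) → G → ℂ, V 0 = U ∧ IsRhoHom ab α V := by
  constructor
  · rintro ⟨-, v, hv⟩
    exact ⟨_, rfl, hv⟩
  · rintro ⟨V, rfl, hV⟩
    refine ⟨hV.zero_mem_Z1, Fin.tail V, ?_⟩
    have h : (Fin.cons (V 0) (Fin.tail V) : Fin (m + 1) → G → ℂ) = V := Fin.cons_self_tail V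
    have h' : IsRhoHom ab α (Fin.cons (V 0) (Fin.tail V) : Fin (m + 1) → G → ℂ) := by rwa [h]
    exact h'

variable (ab α) in
/-- The coboundary of the constant one. -/
def basicCoboundary (γ : G) : ℂ := (α : ℂ) ^ deg ab γ - 1

theorem B1_eq_span : B1 ab α = Submodule.span ℂ {basicCoboundary ab α} := by
  ext U
  rw [Submodule.mem_span_singleton]
  refine exists_congr fun z => ?_
  have h : (groupCohomology.d₀₁ (Rep.of (twisted ab α))).hom z = z • basicCoboundary ab α := by
    funext γ
    change twisted ab α γ z - z = z * _
    rw [twisted_apply, basicCoboundary]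
    ring
  rw [← h]

theorem basicCoboundary_mem_C (m : ℕ) : basicCoboundary ab α ∈ C ab α (m + 2) := by
  rw [mem_C_iff]
  -- The witness is the row coboundary `α ^ |γ| e_0 - e_0 φ(γ)`, with `e_0` the first basis row.
  refine ⟨fun j γ => (if j = 0 then (α : ℂ) ^ deg ab γ else 0) -
    (phi ab (m + 1) γ : Matrix (Fin (m + 1)) (Fin (m + 1)) ℂ) 0 j, ?_, ?_⟩
  · funext γ
    simp [basicCoboundary, phi_col_zero]
  · rw [isRhoHom_iff]
    intro a b j
    have h : (phi ab (m + 1) (a * b) : Matrix (Fin (m + 1)) (Fin (m + 1)) ℂ) =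
        (phi ab (m + 1) a : Matrix (Fin (m + 1)) (Fin (m + 1)) ℂ) * phi ab (m + 1) b := by
      rw [map_mul, Units.val_mul]
    rw [h, Matrix.mul_apply, deg_mul, zpow_add₀ α.ne_zero]
    simp only [sub_mul, Finset.sum_sub_distrib, ite_mul, zero_mul, Finset.sum_ite_eq',
      Finset.mem_univ, if_true, mul_sub, mul_ite, mul_zero]
    ring

theorem Z1_le_C_two : Z1 ab α ≤ C ab α 2 := by
  intro U hU
  rw [mem_Z1_iff] at hU
  refine (mem_C_iff 0 U).2 ⟨fun _ => U, rfl, (isRhoHom_iff ab α _).2 fun a b j => ?_⟩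
  obtain rfl : j = 0 := Fin.fin_one_eq_zero j
  rw [hU]
  simp [phi_col_zero]

theorem C_two : C ab α 2 = Z1 ab α := le_antisymm (fun _ h => h.1) Z1_le_C_two

variable {m : ℕ} {V : Fin (m + 1) → G → ℂ}

theorem IsRhoHom.map_mul_commutator (hV : IsRhoHom ab α V) (j : Fin (m + 1))
    (x y : commutator G) : V j ((x * y : commutator G) : G) = V j (x : G) + V j (y : G) := by
  rw [Subgroup.coe_mul, (isRhoHom_iff ab α V).1 hV, phi_apply, deg_coe, deg_coe]
  simp [Matrix.one_apply, add_comm]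

/-- The functional on the Alexander module induced by an entry of the first row of a
representation. -/
def IsRhoHom.functional (μ : G) (hV : IsRhoHom ab α V) (j : Fin (m + 1)) :
    AlexanderModule μ →ₗ[ℂ] ℂ :=
  AlexanderModule.extend μ (fun y => V j y) (hV.map_mul_commutator j)

variable {μ : G}

/-- Expand the row at `(μyμ⁻¹)μ = μy` in both ways; the terms `V j μ` cancel. This relation is the
source of the action `t ↦ α J⁻¹`. -/
theorem IsRhoHom.sum_conj (hμ : deg ab μ = 1) (hV : IsRhoHom ab α V) (j : Fin (m + 1))
    (y : commutator G) :
    ∑ i, V i (MulAut.conjNormal μ y : commutator G) * jordanMatrix (m + 1) i j = α * V j y := by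
  have h1 := (isRhoHom_iff ab α V).1 hV (MulAut.conjNormal μ y : commutator G) μ j
  have h2 := (isRhoHom_iff ab α V).1 hV μ y j
  have h3 : ((MulAut.conjNormal μ y : commutator G) : G) * μ = μ * y := by
    simp [MulAut.conjNormal_apply]
  rw [h3, h2, phi_apply, phi_apply, deg_coe, deg_coe, hμ, zpow_one, zpow_zero, zpow_one, zpow_zero,
    one_mul, val_jordan] at h1
  simp only [Units.val_one, Matrix.one_apply, mul_ite, mul_one, mul_zero, Finset.sum_ite_eq',
    Finset.mem_univ, if_true] at h1
  linear_combination -h1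

theorem IsRhoHom.functional_isEigen (hμ : deg ab μ = 1) (hV : IsRhoHom ab α V) :
    AlexanderModule.IsEigen α (hV.functional μ 0) := by
  refine AlexanderModule.IsEigen.extend _ _ fun y => ?_
  rw [← hV.sum_conj hμ 0 y, Finset.sum_eq_single 0]
  · simp [jordanMatrix]
  · intro i _ hi
    simp [jordanMatrix, hi]
  · simp

theorem IsRhoHom.functional_succ (hμ : deg ab μ = 1) (hV : IsRhoHom ab α V) (j : Fin m)
    (x : AlexanderModule μ) :
    hV.functional μ j.succ ((LaurentPolynomial.T 1 - LaurentPolynomial.C (α : ℂ)) • x) =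
      -hV.functional μ j.castSucc ((LaurentPolynomial.T 1 : ℂ[T;T⁻¹]) • x) := by
  induction x using AlexanderModule.induction with
  | tmul z y =>
    have h := hV.sum_conj hμ j.succ y
    rw [sum_mul_jordanMatrix_succ] at h
    rw [sub_smul, AlexanderModule.C_smul, AlexanderModule.T_smul_tmul, map_sub, map_smul]
    simp only [IsRhoHom.functional, AlexanderModule.extend_tmul, smul_eq_mul]
    linear_combination z * h
  | add x y hx hy =>
    rw [smul_add, smul_add, map_add, map_add, hx, hy]
    ring

/-- This is the obstruction to long rows: if `(t - α)^j` kills `x` and the row has an entry in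
position `j`, then the leading functional vanishes at `x`. -/
theorem IsRhoHom.functional_pow (hμ : deg ab μ = 1) (hV : IsRhoHom ab α V) (j : ℕ)
    (hj : j < m + 1) (x : AlexanderModule μ) :
    hV.functional μ ⟨j, hj⟩ ((LaurentPolynomial.T 1 - LaurentPolynomial.C (α : ℂ)) ^ j • x) =
      (-α : ℂ) ^ j * hV.functional μ 0 x := by
  induction j generalizing x with
  | zero => simp
  | succ j ih =>
    have h := hV.functional_succ hμ ⟨j, by omega⟩
      ((LaurentPolynomial.T 1 - LaurentPolynomial.C (α : ℂ)) ^ j • x)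
    rw [← mul_smul, ← pow_succ', smul_comm] at h
    refine h.trans ?_
    have h2 := ih (by omega) ((LaurentPolynomial.T 1 : ℂ[T;T⁻¹]) • x)
    rw [hV.functional_isEigen hμ] at h2
    simp only [Fin.castSucc_mk, h2]
    ring

end Cocycles

/-! ### The basis of the space of cocycles -/

section Basis

variable {ab : Abelianization G ≃* Multiplicative ℤ} {μ : G} (hμ : deg ab μ = 1)
  {Δ : ℂ[T;T⁻¹]} (D : AlexanderDecomposition μ Δ) (α : D.roots)

/-- The cocycle on the group induced by a functional on the Alexander module. -/
def functionalCocycle (h : AlexanderModule μ →ₗ[ℂ] ℂ) (γ : G) : ℂ :=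
  h (AlexanderModule.tmul μ 1 (commPart ab hμ γ))

theorem functionalCocycle_coe (h : AlexanderModule μ →ₗ[ℂ] ℂ) (y : commutator G) :
    functionalCocycle hμ h (y : G) = h (AlexanderModule.tmul μ 1 y) := by
  rw [functionalCocycle, commPart_coe]

theorem functionalCocycle_self (h : AlexanderModule μ →ₗ[ℂ] ℂ) : functionalCocycle hμ h μ = 0 := by
  rw [functionalCocycle, commPart_self, AlexanderModule.tmul_one, map_zero]

theorem functionalCocycle_dual_mem_C (i : Fin (D.k α)) (m : ℕ) (hm : m + 1 ≤ D.q α i) :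
    functionalCocycle hμ (D.dual α i) ∈ C ab (α : ℂˣ) (m + 2) := by
  rw [mem_C_iff]
  -- For `γ = y μ ^ |γ|`, let the row be the top row of the action of the `i`-th coordinate of `y`,
  -- multiplied by `φ(γ)`.
  refine ⟨fun j γ => (D.coordEval α i hm (AlexanderModule.tmul μ 1 (commPart ab hμ γ)) *
    (phi ab (m + 1) γ : Matrix (Fin (m + 1)) (Fin (m + 1)) ℂ)) 0 j, ?_, ?_⟩
  · funext γ
    rw [functionalCocycle, ← D.corner_eq_dual α i hm]
    simp only [Matrix.mul_apply, phi_col_zero, mul_ite, mul_one, mul_zero, Finset.sum_ite_eq',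
      Finset.mem_univ, if_true]
    rfl
  · rw [isRhoHom_iff]
    intro a b j
    have h : D.coordEval α i hm (AlexanderModule.tmul μ 1 (commPart ab hμ (a * b))) *
        (phi ab (m + 1) (a * b) : Matrix (Fin (m + 1)) (Fin (m + 1)) ℂ) =
        ((α : ℂˣ) : ℂ) ^ deg ab a •
          (D.coordEval α i hm (AlexanderModule.tmul μ 1 (commPart ab hμ b)) * (phi ab (m + 1) b)) +
        D.coordEval α i hm (AlexanderModule.tmul μ 1 (commPart ab hμ a)) * (phi ab (m + 1) a) *
          (phi ab (m + 1) b) := by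
      -- Conjugation by `μ ^ |a|` contributes `α ^ |a| φ(a)⁻¹`, and the inverse cancels against
      -- `φ(ab) = φ(a) φ(b)`.
      rw [commPart_mul, AlexanderModule.tmul_mul, ← AlexanderModule.T_smul_tmul_zpow, map_add,
        D.coordEval_smul, jordanEval_T, ← phi_apply, map_mul, Units.val_mul, add_mul,
        mul_smul_comm, smul_mul_assoc]
      simp only [mul_assoc, Units.inv_mul_cancel_left]
      exact add_comm _ _
    rw [h, Matrix.add_apply, Matrix.smul_apply, Matrix.mul_apply (M := _ * _), smul_eq_mul]

/-- For `α = 1` a dual cocycle would be a homomorphism to an abelian group, hence zero on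
commutators; but the dual functional is `1` on its generator. -/
theorem root_ne_one (hμ : deg ab μ = 1) (i : Fin (D.k α)) : (α : ℂˣ) ≠ 1 := by
  intro hα
  have h := (functionalCocycle_dual_mem_C hμ D α i 0 (D.one_le_q α i)).1
  rw [mem_Z1_iff] at h
  simp only [hα, Units.val_one, one_zpow, one_mul] at h
  let f : G →* Multiplicative ℂ := MonoidHom.mk'
    (fun γ => Multiplicative.ofAdd (functionalCocycle hμ (D.dual α i) γ)) fun a b => by
      rw [h, add_comm, ofAdd_add]
  have h0 : D.dual α i = 0 := by
    apply AlexanderModule.hom_ext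
    intro y
    have hy : f y = 1 := by
      have := Abelianization.commutator_subset_ker f y.2
      exact this
    rw [← functionalCocycle_coe hμ]
    exact Multiplicative.ofAdd.injective hy
  have h1 := D.dual_gen α i i
  rw [h0] at h1
  simp at h1

/-- The basis of the space of cocycles consisting of a coboundary and the cocycles dual to the
generators of the cyclic summands. -/
def cocycleBasis : Option (Fin (D.k α)) → G → ℂ
  | none => basicCoboundary ab (α : ℂˣ)
  | some i => functionalCocycle hμ (D.dual α i)

/-- Evaluation at `μ` isolates the coboundary, whose value there is `α - 1`; restriction to
commutators and evaluation at the generators isolate the rest. -/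
theorem linearIndependent_cocycleBasis (hα : (α : ℂˣ) ≠ 1) :
    LinearIndependent ℂ (cocycleBasis hμ D α) := by
  have hα' : ((α : ℂˣ) : ℂ) - 1 ≠ 0 := sub_ne_zero.2 fun h => hα (Units.ext h)
  rw [Fintype.linearIndependent_iff]
  intro c hc
  rw [Fintype.sum_option] at hc
  have h0 : c none = 0 := by
    have h := congrFun hc μ
    simp only [cocycleBasis, Pi.add_apply, Finset.sum_apply, Pi.smul_apply, functionalCocycle_self,
      basicCoboundary, hμ, zpow_one, smul_eq_mul, mul_zero, Finset.sum_const_zero, add_zero,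
      Pi.zero_apply] at h
    exact (mul_eq_zero.1 h).resolve_right hα'
  have h1 : ∑ i, c (some i) • D.dual α i = 0 := by
    apply AlexanderModule.hom_ext
    intro y
    have h := congrFun hc (y : G)
    rw [h0, zero_smul, zero_add] at h
    simpa [cocycleBasis, functionalCocycle_coe, LinearMap.sum_apply] using h
  rintro (_ | j)
  · exact h0
  · have h := congrArg (fun f => f (D.gen α j)) h1
    simpa [LinearMap.sum_apply, D.dual_gen] using h

/-- The indices of the basis vectors of the space of cocycles lying in the `m`-th subspace. -/
def basisIndices (m : ℕ) : Finset (Option (Fin (D.k α))) :=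
  Finset.insertNone (Finset.univ.filter fun i => m ≤ D.q α i)

theorem isRhoHom_zero_eq_sum (hα : (α : ℂˣ) ≠ 1) {m : ℕ} {V : Fin (m + 1) → G → ℂ}
    (hV : IsRhoHom ab (α : ℂˣ) V) :
    V 0 = (V 0 μ / ((α : ℂˣ) - 1 : ℂ)) • basicCoboundary ab (α : ℂˣ) +
      ∑ i, hV.functional μ 0 (D.gen α i) • functionalCocycle hμ (D.dual α i) := by
  have hα' : ((α : ℂˣ) : ℂ) - 1 ≠ 0 := sub_ne_zero.2 fun h => hα (Units.ext h)
  have hU := (mem_Z1_iff _).1 hV.zero_mem_Z1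
  funext γ
  have h1 : γ = commPart ab hμ γ * μ ^ deg ab γ := by simp [commPart]
  have h2 : V 0 (μ ^ deg ab γ) =
      V 0 μ / ((α : ℂˣ) - 1 : ℂ) * (((α : ℂˣ) : ℂ) ^ deg ab γ - 1) := by
    -- Expanding both `μ ^ k * μ` and `μ * μ ^ k` gives a linear equation for `V 0 (μ ^ k)`,
    -- avoiding the geometric sum over integer exponents.
    have h3 := hU (μ ^ deg ab γ) μ
    rw [(Commute.zpow_self μ _).eq, hU, deg_zpow, hμ, mul_one, zpow_one] at h3
    field_simp
    linear_combination h3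
  have h4 : V 0 (commPart ab hμ γ : G) =
      hV.functional μ 0 (AlexanderModule.tmul μ 1 (commPart ab hμ γ)) := by
    rw [IsRhoHom.functional, AlexanderModule.extend_tmul, one_mul]
  rw [D.isEigen_eq_sum α (hV.functional_isEigen hμ)] at h4
  conv_lhs => rw [h1, hU, deg_coe, zpow_zero, one_mul, h2, h4]
  simp [LinearMap.sum_apply, functionalCocycle, basicCoboundary]

theorem C_eq_span (hα : (α : ℂˣ) ≠ 1) (m : ℕ) : C ab (α : ℂˣ) (m + 2) =
    Submodule.span ℂ (cocycleBasis hμ D α '' basisIndices D α (m + 1)) := by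
  apply le_antisymm
  · intro U hU
    obtain ⟨V, rfl, hV⟩ := (mem_C_iff m U).1 hU
    rw [isRhoHom_zero_eq_sum hμ D α hα hV]
    refine add_mem (Submodule.smul_mem _ _ (Submodule.subset_span ⟨none, ?_, rfl⟩))
      (sum_mem fun i _ => ?_)
    · simp [basisIndices]
    · by_cases hi : m + 1 ≤ D.q α i
      · refine Submodule.smul_mem _ _ (Submodule.subset_span ⟨some i, ?_, rfl⟩)
        simpa [basisIndices] using hi
      -- Here `q ≤ m`, so the row has an entry in position `q`, while `(t - α)^q` kills the
      -- generator: its coefficient is zero.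
      · have h := hV.functional_pow hμ (D.q α i) (by omega) (D.gen α i)
        rw [D.pow_smul_gen, map_zero, eq_comm] at h
        have h0 : hV.functional μ 0 (D.gen α i) = 0 :=
          (mul_eq_zero.1 h).resolve_left (pow_ne_zero _ (neg_ne_zero.2 (Units.ne_zero _)))
        rw [h0, zero_smul]
        exact zero_mem _
  · rw [Submodule.span_le]
    rintro _ ⟨_ | i, hi, rfl⟩
    · exact basicCoboundary_mem_C m
    · exact functionalCocycle_dual_mem_C hμ D α i m (by simpa [basisIndices] using hi)

/-- The summand `1` counts the coboundary. -/
theorem finrank_C (hμ : deg ab μ = 1) (hα : (α : ℂˣ) ≠ 1) (m : ℕ) :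
    Module.finrank ℂ (C ab (α : ℂˣ) (m + 2)) =
    (Finset.univ.filter fun i => m + 1 ≤ D.q α i).card + 1 := by
  have hli := (linearIndependent_cocycleBasis hμ D α hα).comp
    ((↑) : basisIndices D α (m + 1) → _) Subtype.val_injective
  have h := finrank_span_eq_card hli
  rw [Set.range_comp, Subtype.range_coe_subtype, Fintype.card_coe] at h
  rw [C_eq_span hμ D α hα]
  refine h.trans ?_
  rw [basisIndices, Finset.card_insertNone]

end Basis

end KnotModule

end

noncomputable section

namespace KnotModule

/-! ### Reindexing direct sums of cyclic modules -/

section Reindex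

/-- Equality of exponents identifies cyclic modules. -/
def Cyclic.congr (β : ℂˣ) {m n : ℕ} (h : m = n) : Cyclic β m ≃ₗ[ℂ[T;T⁻¹]] Cyclic β n :=
  h ▸ LinearEquiv.refl _ _

/-- A finite index set is the union of the fibres of a positive function on it. -/
theorem exists_equiv_sigma_fiber {ι : Type} [Fintype ι] (q : ι → ℕ) (hq : ∀ i, 1 ≤ q i) (d : ℕ → ℕ)
    (hd : ∀ m, d m = (Finset.univ.filter fun i => q i = m + 1).card) :
    ∃ e : ι ≃ Σ m, Fin (d m), ∀ s, q (e.symm s) = s.1 + 1 := by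
  have hcard : ∀ m, Nonempty (Fin (d m) ≃ {i // q i - 1 = m}) := fun m =>
    Fintype.card_eq.1 <| by
      rw [Fintype.card_fin, hd, Fintype.card_subtype]
      congr 1
      ext i
      have := hq i
      simp only [Finset.mem_filter, Finset.mem_univ, true_and]
      omega
  -- Exponent `m + 1` is indexed by `m`; the truncated `q i - 1` loses nothing because `q i ≥ 1`.
  let e := (Equiv.sigmaFiberEquiv fun i => q i - 1).symm.trans
    (Equiv.sigmaCongrRight fun m => (hcard m).some.symm)
  refine ⟨e, fun s => ?_⟩
  have h : q (e.symm s) - 1 = s.1 := ((hcard s.1).some s.2).2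
  have := hq (e.symm s)
  omega

/-- Grouping the summands by exponent shows that the multiplicities alone determine the direct sum
up to isomorphism. -/
theorem nonempty_directSum_equiv_fiber {ι : Type} [Fintype ι] (β : ℂˣ) (q : ι → ℕ)
    (hq : ∀ i, 1 ≤ q i) (d : ℕ → ℕ)
    (hd : ∀ m, d m = (Finset.univ.filter fun i => q i = m + 1).card) :
    Nonempty ((⨁ i, Cyclic β (q i)) ≃ₗ[ℂ[T;T⁻¹]] ⨁ m : ℕ, ⨁ _ : Fin (d m), Cyclic β (m + 1)) := by
  obtain ⟨e, he⟩ := exists_equiv_sigma_fiber q hq d hd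
  exact ⟨(DirectSum.lequivCongrLeft ℂ[T;T⁻¹] (M := fun i => Cyclic β (q i)) e).trans
    ((DFinsupp.mapRange.linearEquiv fun s => Cyclic.congr β (he s)).trans
      (DirectSum.sigmaLcurryEquiv ℂ[T;T⁻¹] (δ := fun m (_ : Fin (d m)) => Cyclic β (m + 1))))⟩

end Reindex

/-! ### The main theorem for a group with infinite cyclic abelianization -/

section Main

variable {G : Type} [Group G] {ab : Abelianization G ≃* Multiplicative ℤ} {μ : G}
  {Δ : ℂ[T;T⁻¹]} (D : AlexanderDecomposition μ Δ) (α : D.roots)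

theorem finrank_C_sub (hμ : deg ab μ = 1) (hα : (α : ℂˣ) ≠ 1) (m : ℕ) :
    Module.finrank ℂ (C ab (α : ℂˣ) (m + 2)) = Module.finrank ℂ (C ab (α : ℂˣ) (m + 3)) +
      (Finset.univ.filter fun i => D.q α i = m + 1).card := by
  rw [finrank_C D α hμ hα, finrank_C D α hμ hα (m + 1), add_right_comm,
    ← Finset.card_union_of_disjoint]
  · congr 2
    ext i
    simp only [Finset.mem_filter, Finset.mem_univ, true_and, Finset.mem_union]
    omega
  · rw [Finset.disjoint_filter]
    intro i _ h
    omega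

theorem C_succ_le (hμ : deg ab μ = 1) (hα : (α : ℂˣ) ≠ 1) (m : ℕ) :
    C ab (α : ℂˣ) (m + 3) ≤ C ab (α : ℂˣ) (m + 2) := by
  rw [C_eq_span hμ D α hα m, C_eq_span hμ D α hα (m + 1)]
  refine Submodule.span_mono (Set.image_mono ?_)
  rintro (_ | i) hi
  · simp [basisIndices]
  · simp only [basisIndices, Finset.mem_coe, Finset.some_mem_insertNone, Finset.mem_filter,
      Finset.mem_univ, true_and] at hi ⊢
    omega

theorem B1_eq_C (hμ : deg ab μ = 1) (hα : (α : ℂˣ) ≠ 1) (m : ℕ) (hm : ∀ i, D.q α i ≤ m) :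
    B1 ab (α : ℂˣ) = C ab (α : ℂˣ) (m + 2) := by
  rw [C_eq_span hμ D α hα, B1_eq_span]
  have h : (Finset.univ.filter fun i => m + 1 ≤ D.q α i) = ∅ :=
    Finset.filter_eq_empty_iff.2 fun i _ => by have := hm i; omega
  have h' : (basisIndices D α (m + 1) : Set (Option (Fin (D.k α)))) = {none} := by
    rw [basisIndices, h]
    ext o
    simp [Finset.mem_insertNone, Option.eq_none_iff_forall_not_mem]
  rw [h', Set.image_singleton]
  rfl

theorem finiteDimensional_Z1 (hμ : deg ab μ = 1) (hα : (α : ℂˣ) ≠ 1) :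
    FiniteDimensional ℂ (Z1 ab (α : ℂˣ)) := by
  rw [← C_two, C_eq_span hμ D α hα 0]
  exact FiniteDimensional.span_of_finite ℂ ((Finset.finite_toSet _).image _)

end Main

end KnotModule

end

theorem mainTheorem2 (K : KnotModule.Knot) (x₀ : K.Exterior)
    (μ : K.group x₀) (hμ : K.IsMeridian μ)
    (ab : Abelianization (K.group x₀) ≃* Multiplicative ℤ)
    (hab : ab (Abelianization.of μ) = Multiplicative.ofAdd 1)
    (Δ : ℂ[T;T⁻¹]) (hΔ : KnotModule.IsAlexanderPolynomial μ Δ)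
    (D : KnotModule.AlexanderDecomposition μ Δ) :
    (∀ α : ℂˣ, KnotModule.IsRoot Δ α →
      FiniteDimensional ℂ (KnotModule.Z1 ab α) ∧
      (∃ hk : 0 < D.k α,
        KnotModule.B1 ab α = KnotModule.C ab α (D.q α ⟨D.k α - 1, Nat.sub_one_lt_of_lt hk⟩ + 2) ∧
        KnotModule.C ab α (D.q α ⟨D.k α - 1, Nat.sub_one_lt_of_lt hk⟩ + 2) <
          KnotModule.C ab α (D.q α ⟨D.k α - 1, Nat.sub_one_lt_of_lt hk⟩ + 1)) ∧
      (∀ n : ℕ, 2 ≤ n → KnotModule.C ab α (n + 1) ≤ KnotModule.C ab α n) ∧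
      KnotModule.C ab α 2 = KnotModule.Z1 ab α ∧
      (∀ p : ℕ, 3 ≤ p →
        (Module.finrank ℂ (KnotModule.C ab α (p - 1)) : ℤ) -
            Module.finrank ℂ (KnotModule.C ab α p) =
          (Finset.univ.filter fun i : Fin (D.k α) => D.q α i = p - 2).card)) ∧
    Nonempty (KnotModule.AlexanderModule μ ≃ₗ[ℂ[T;T⁻¹]]
      ⨁ β : {β : ℂˣ // KnotModule.IsRoot Δ β}, ⨁ m : ℕ,
        ⨁ _ : Fin (Module.finrank ℂ (KnotModule.C ab β (m + 2)) -
            Module.finrank ℂ (KnotModule.C ab β (m + 3))),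
          KnotModule.Cyclic (β : ℂˣ) (m + 1)) := by
  have hdeg : KnotModule.deg ab μ = 1 := congrArg Multiplicative.toAdd hab
  have hk : ∀ α : D.roots, 0 < D.k α := fun α => D.k_pos α hΔ
  have hne : ∀ α : D.roots, (α : ℂˣ) ≠ 1 := fun α =>
    KnotModule.root_ne_one D α hdeg ⟨0, hk α⟩
  refine ⟨fun α' hα' => ?_, ?_⟩
  · obtain ⟨α, rfl⟩ : ∃ α : D.roots, (α : ℂˣ) = α' := ⟨⟨α', (D.mem_roots α').2 hα'⟩, rfl⟩
    refine ⟨KnotModule.finiteDimensional_Z1 D α hdeg (hne α), ⟨hk α, ?_, ?_⟩, fun n hn => ?_,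
      KnotModule.C_two, fun p hp => ?_⟩
    -- By monotonicity the last exponent bounds all the others.
    · refine KnotModule.B1_eq_C D α hdeg (hne α) _ fun i => D.monotone_q α ?_
      rw [Fin.le_def]
      have := i.2
      simp only
      omega
    · obtain ⟨m, hm⟩ := Nat.exists_eq_add_of_le'
        (D.one_le_q α ⟨D.k α - 1, Nat.sub_one_lt_of_lt (hk α)⟩)
      rw [hm]
      refine lt_of_le_of_ne (KnotModule.C_succ_le D α hdeg (hne α) m) fun h => ?_
      -- The last exponent is itself `m + 1`, so the dimension drops by at least one here.
      have h1 := KnotModule.finrank_C_sub D α hdeg (hne α) m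
      have h2 : 0 < (Finset.univ.filter fun i => D.q α i = m + 1).card :=
        Finset.card_pos.2 ⟨_, Finset.mem_filter.2 ⟨Finset.mem_univ _, hm⟩⟩
      have h3 : KnotModule.C ab (α : ℂˣ) (m + 3) = KnotModule.C ab (α : ℂˣ) (m + 2) := h
      rw [h3] at h1
      omega
    · obtain ⟨m, rfl⟩ := Nat.exists_eq_add_of_le' hn
      exact KnotModule.C_succ_le D α hdeg (hne α) m
    · obtain ⟨m, rfl⟩ := Nat.exists_eq_add_of_le' hp
      have h1 := KnotModule.finrank_C_sub D α hdeg (hne α) m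
      change (Module.finrank ℂ (KnotModule.C ab (α : ℂˣ) (m + 2)) : ℤ) - _ =
        (Finset.univ.filter fun i : Fin (D.k α) => D.q α i = m + 1).card
      rw [h1]
      push_cast
      ring
  -- The natural-number subtraction is exact, since the larger rank is the smaller one plus a
  -- cardinality.
  · have hd : ∀ (α : D.roots) (m : ℕ), Module.finrank ℂ (KnotModule.C ab (α : ℂˣ) (m + 2)) -
        Module.finrank ℂ (KnotModule.C ab (α : ℂˣ) (m + 3)) =
          (Finset.univ.filter fun i => D.q α i = m + 1).card := fun α m => by
      rw [KnotModule.finrank_C_sub D α hdeg (hne α) m, Nat.add_sub_cancel_left]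
    have f := fun α : D.roots => (KnotModule.nonempty_directSum_equiv_fiber (α : ℂˣ) (D.q α)
      (D.one_le_q α) _ (hd α)).some
    let e : D.roots ≃ {β : ℂˣ // KnotModule.IsRoot Δ β} := Equiv.subtypeEquivRight D.mem_roots
    exact ⟨D.iso.trans ((DFinsupp.mapRange.linearEquiv f).trans
      (DirectSum.lequivCongrLeft ℂ[T;T⁻¹] (M := fun β : D.roots => ⨁ m : ℕ,
        ⨁ _ : Fin (Module.finrank ℂ (KnotModule.C ab (β : ℂˣ) (m + 2)) -
            Module.finrank ℂ (KnotModule.C ab (β : ℂˣ) (m + 3))),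
          KnotModule.Cyclic (β : ℂˣ) (m + 1)) e))⟩
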